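/- Let $P$ be a poset (partially ordered set). A subset $X\subseteq P$ is *centered* if every finite subset of $X$ has a common lower bound in $P$. The poset $P$ has *precaliber $\omega_1$* if every uncountable subset of $P$ has an uncountable centered subset, and $P$ is *$\sigma$-centered* if it is a union of countably many centered subsets. A subset $D\subseteq P$ is *dense* if for every $p\in P$ there is $d\in D$ with $d\le p$. A *filter* on $P$ is a nonempty upward closed set $G\subseteq P$ such that any two elements of $G$ have a common lower bound in $G$. Let $\mathrm{MA}_{\omega_1}(\text{precaliber }\omega_1)$ be the assertion that for every nonempty poset $P$ (of any size) with precaliber $\omega_1$ and every family $\mathcal D$ of at most $\omega_1$ dense subsets of $P$, there is a filter $G$ on $P$ with $G\cap D\neq\emptyset$ for all $D\in\mathcal D$. **Theorem 1.5.** If every poset of size $\omega_1$ with precaliber $\omega_1$ is $\sigma$-centered, then $\mathrm{MA}_{\omega_1}(\text{precaliber }\omega_1)$ holds. -/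

import Mathlib

universe u v

open Cardinal

/-- A subset `X` of a poset is centered if every finite subset of `X` has a common lower bound
(in the whole poset, not necessarily in `X`). -/
def IsCentered {P : Type u} [PartialOrder P] (X : Set P) : Prop :=
  ∀ F : Finset P, (F : Set P) ⊆ X → ∃ p : P, ∀ q ∈ F, p ≤ q

/-- A poset has precaliber `ω₁` if every uncountable subset has an uncountable centered subset. -/
def HasPrecaliberOmegaOne (P : Type u) [PartialOrder P] : Prop :=
  ∀ X : Set P, ¬ X.Countable → ∃ Y : Set P, Y ⊆ X ∧ ¬ Y.Countable ∧ IsCentered Y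

/-- A poset is `σ`-centered if it is a countable union of centered subsets. -/
def IsSigmaCentered (P : Type u) [PartialOrder P] : Prop :=
  ∃ C : ℕ → Set P, (∀ n, IsCentered (C n)) ∧ ⋃ n, C n = Set.univ

/-- Density in the sense of forcing: every condition has an extension (a smaller element)
in `D`. -/
def IsForcingDense {P : Type u} [PartialOrder P] (D : Set P) : Prop :=
  ∀ p : P, ∃ d ∈ D, d ≤ p

/-- Every poset of size `ω₁` with precaliber `ω₁` is `σ`-centered. -/
def PrecaliberImpliesSigmaCentered : Prop :=
  ∀ (P : Type u) [PartialOrder P], #P = ℵ₁ → HasPrecaliberOmegaOne P → IsSigmaCentered P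

/-- Martin's axiom at `ω₁` for posets with precaliber `ω₁`: for every nonempty poset with
precaliber `ω₁` (of arbitrary size) and every family of at most `ω₁` dense subsets, some filter
meets all members of the family. -/
def MartinAxiomPrecaliber : Prop :=
  ∀ (P : Type u) [PartialOrder P] [Nonempty P], HasPrecaliberOmegaOne P →
    ∀ 𝒟 : Set (Set P), #𝒟 ≤ ℵ₁ → (∀ D ∈ 𝒟, IsForcingDense D) →
      ∃ G : Order.PFilter P, ∀ D ∈ 𝒟, ((G : Set P) ∩ D).Nonempty

/-! Closing off under witnesses of density and lower bounds of finite sets replaces `P` by a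
subposet `A` of size at most `ℵ₁`, still of precaliber `ω₁`. So `A` is covered by centered upward
closed sets `C n`. It is enough to choose pairwise compatible elements from `ω₁` dense sets, since
adding dense sets that decide pairs turns such a choice into a filter.

Suppose one `x : ℕ → ℕ` is such that every `D α` starts, at some position, a descending chain whose
element at position `i` lies in `C (x i)`. Two such chains pass through the same centered set later
on, so their first elements are compatible. For the `α < δ`, enumerated in type at most `ω`, finite
approximations to `x` always extend. The difficulty is to find one `x` that works for unboundedly
many `δ < ω₁` (`exists_branch`).

For this the hypothesis is applied to a second poset, `WitnessPoset`: finite sets of limit ordinals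
with an approximation `x` good for all members, such that `r α` and `r β` agree below `x n` whenever
the ladders of `α ≠ β` agree below `n`. Pressing down gives precaliber `ω₁`. Once the poset is
`σ`-centered, one piece contains the singletons of an unbounded set `S` in which ladders of distinct
members agree arbitrarily long. The first difference of the corresponding reals bounds `x n` for all
finite subsets of `S` at once, and compactness yields the branch. -/

/-- All initial segments are countable. -/
class CountableSegments (W : Type*) [Preorder W] : Prop where
  countable_Iic : ∀ a : W, (Set.Iic a).Countable

/-- `c` is a strictly increasing cofinal sequence below `δ`. -/
structure IsLadder {W : Type*} [LinearOrder W] (c : ℕ → W) (δ : W) : Prop where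
  strictMono : StrictMono c
  lt : ∀ n, c n < δ
  cofinal : ∀ β < δ, ∃ n, β < c n

/-- `δ` has a strictly increasing cofinal sequence below it. -/
def HasLadder {W : Type*} [LinearOrder W] (δ : W) : Prop := ∃ c : ℕ → W, IsLadder c δ

theorem HasLadder.exists_bound {W : Type*} [LinearOrder W] {γ : W} (hγ : HasLadder γ) {s : Set W} (hs : s.Finite)
    (h : ∀ a ∈ s, a < γ) : ∃ η < γ, ∀ a ∈ s, a < η := by
  obtain ⟨c, hc⟩ := hγ
  induction s, hs using Set.Finite.induction_on with
  | empty => exact ⟨c 0, hc.lt 0, by simp⟩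
  | @insert a s _ _ ih =>
    obtain ⟨η, hη, hs⟩ := ih fun b hb => h b (Set.mem_insert_of_mem _ hb)
    obtain ⟨n, hn⟩ := hc.cofinal a (h a (Set.mem_insert _ _))
    refine ⟨max η (c n), max_lt hη (hc.lt n), ?_⟩
    rintro b (rfl | hb)
    · exact lt_max_of_lt_right hn
    · exact lt_max_of_lt_left (hs b hb)

/-! ### Pressing down on `ω₁` -/

section OmegaOne

variable {W : Type*} [LinearOrder W] [Uncountable W] [CountableSegments W]

theorem exists_gt_of_countable {s : Set W} (hs : s.Countable) : ∃ b, ∀ a ∈ s, a < b := by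
  by_contra! hcon
  refine Set.not_countable_univ (α := W) ((hs.biUnion fun a _ =>
    CountableSegments.countable_Iic a).mono fun b _ => ?_)
  obtain ⟨a, ha, hba⟩ := hcon b
  exact Set.mem_biUnion ha hba

/-- A relational form of Fodor's lemma. -/
theorem pressing_down [WellFoundedLT W] {K : Type*} [Countable K] (h : W → W)
    (Φ : W → W → K → Prop)
    (H : ∀ γ, HasLadder γ → ∃ η < γ, ∃ κ, Φ γ η κ) :
    ∃ η κ, ∀ b, ∃ γ, b < γ ∧ HasLadder γ ∧ (∀ β < γ, h β < γ) ∧ Φ γ η κ := by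
  by_contra! hcon
  choose b hb using hcon
  -- The supremum `γ` of the iterates of this step has a ladder, is closed under `h`, and exceeds `b
  -- η κ` for all `η < γ`, which contradicts the choice of `b`.
  have hstep : ∀ β : W, ∃ β', β < β' ∧ (∀ ξ ≤ β, h ξ < β') ∧ ∀ ξ ≤ β, ∀ κ, b ξ κ < β' := by
    intro β
    have hc := CountableSegments.countable_Iic β
    have hc' : Countable (Set.Iic β) := hc.to_subtype
    obtain ⟨β', hβ'⟩ := exists_gt_of_countable
      ((Set.countable_singleton β).union ((hc.image h).union
        (Set.countable_range fun p : Set.Iic β × K => b p.1 p.2)))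
    refine ⟨β', hβ' _ (by simp), fun ξ hξ => hβ' _ ?_, fun ξ hξ κ => hβ' _ ?_⟩
    · exact Or.inr (Or.inl ⟨ξ, hξ, rfl⟩)
    · exact Or.inr (Or.inr ⟨(⟨ξ, hξ⟩, κ), rfl⟩)
  choose next hlt hh hbn using hstep
  obtain ⟨a⟩ : Nonempty W := inferInstance
  let δ : ℕ → W := fun n => next^[n] a
  have hδ : ∀ n, δ (n + 1) = next (δ n) := fun n => Function.iterate_succ_apply' next n a
  have hmono : StrictMono δ := strictMono_nat_of_lt_succ fun n => by rw [hδ]; exact hlt _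
  obtain ⟨b₀, hb₀⟩ := exists_gt_of_countable (Set.countable_range δ)
  obtain ⟨γ, hγ, hmin⟩ := WellFounded.has_min (wellFounded_lt (α := W)) {γ | ∀ n, δ n < γ}
    ⟨b₀, fun n => hb₀ _ ⟨n, rfl⟩⟩
  have hcof : ∀ β < γ, ∃ n, β ≤ δ n := by
    intro β hβ
    by_contra! hc
    exact hmin β hc hβ
  have hlad : HasLadder γ := by
    refine ⟨δ, hmono, hγ, fun β hβ => ?_⟩
    obtain ⟨n, hn⟩ := hcof β hβ
    exact ⟨n + 1, hn.trans_lt (hmono n.lt_succ_self)⟩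
  obtain ⟨η, hη, κ, hΦ⟩ := H γ hlad
  obtain ⟨n, hn⟩ := hcof η hη
  refine hb η κ γ ?_ hlad ?_ hΦ
  · exact ((hbn _ η hn κ).trans_eq (hδ n).symm).trans (hγ _)
  · intro β hβ
    obtain ⟨n, hn⟩ := hcof β hβ
    exact ((hh _ β hn).trans_eq (hδ n).symm).trans (hγ _)

end OmegaOne

theorem exists_injOn_Iio (W : Type*) [LinearOrder W] [CountableSegments W] :
    ∃ e : W → W → ℕ, ∀ η, Set.InjOn (e η) (Set.Iio η) := by
  have : ∀ η : W, ∃ e : W → ℕ, Set.InjOn e (Set.Iio η) := fun η =>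
    Set.countable_iff_exists_injOn.1
      ((CountableSegments.countable_Iic η).mono Set.Iio_subset_Iic_self)
  exact Classical.axiom_of_choice this

theorem exists_omegaOne : ∃ (W : Type v) (_ : LinearOrder W),
    WellFoundedLT W ∧ Uncountable W ∧ CountableSegments W ∧ #W = ℵ₁ := by
  have hc : #((ℵ₁ : Cardinal.{v}).ord.ToType) = ℵ₁ := by simp
  refine ⟨(ℵ₁ : Cardinal.{v}).ord.ToType, inferInstance, inferInstance, ?_, ⟨fun a => ?_⟩, hc⟩
  · rw [← Cardinal.aleph0_lt_mk_iff, hc]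
    exact Cardinal.aleph0_lt_aleph_one
  · rw [← Set.Iio_insert]
    refine Set.Countable.insert _ ?_
    rw [← Cardinal.le_aleph0_iff_set_countable, ← Order.lt_succ_iff, Cardinal.succ_aleph0]
    simpa using Cardinal.mk_Iio_lt a

/-- The hypothesis transferred to posets of size at most `ℵ₁` in any universe. -/
theorem PrecaliberImpliesSigmaCentered.isSigmaCentered (h : PrecaliberImpliesSigmaCentered.{u})
    {P : Type v} [PartialOrder P] [Nonempty P] (hP : #P ≤ ℵ₁) (hpre : HasPrecaliberOmegaOne P) :
    IsSigmaCentered P := by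
  rcases hP.lt_or_eq with hlt | heq
  -- The hypothesis speaks of size exactly `ℵ₁`; a countable poset is the union of its singletons.
  · rw [← Cardinal.succ_aleph0, Order.lt_succ_iff, Cardinal.mk_le_aleph0_iff] at hlt
    obtain ⟨f, hf⟩ := exists_surjective_nat P
    refine ⟨fun n => {f n}, fun n F hF => ⟨f n, fun q hq => ?_⟩, ?_⟩
    · exact (hF hq).ge
    · ext p
      simpa [eq_comm] using hf p
  · obtain ⟨φ⟩ : Nonempty (P ≃ (ℵ₁ : Cardinal.{u}).out) := by
      rw [← Cardinal.lift_mk_eq', heq]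
      simp
    let : PartialOrder (ℵ₁ : Cardinal.{u}).out := PartialOrder.lift φ.symm φ.symm.injective
    have hle : ∀ a b : (ℵ₁ : Cardinal.{u}).out, a ≤ b ↔ φ.symm a ≤ φ.symm b := fun _ _ => Iff.rfl
    obtain ⟨C, hC, hU⟩ := h (ℵ₁ : Cardinal.{u}).out (by simp) <| by
      intro X hX
      obtain ⟨Y, hYX, hY, hYc⟩ := hpre (φ.symm '' X) fun hc =>
        hX (by simpa using hc.image φ)
      refine ⟨φ.symm ⁻¹' Y, fun y hy => ?_, fun hc => hY ?_, fun F hF => ?_⟩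
      · simpa using hYX hy
      · simpa using hc.image φ.symm
      · obtain ⟨p, hp⟩ := hYc (F.map φ.symm.toEmbedding) (by
          intro y hy
          simp only [Finset.coe_map, Set.mem_image] at hy
          obtain ⟨z, hz, rfl⟩ := hy
          exact hF hz)
        refine ⟨φ p, fun q hq => ?_⟩
        rw [hle, φ.symm_apply_apply]
        exact hp _ (Finset.mem_map_of_mem _ hq)
    refine ⟨fun n => φ ⁻¹' C n, fun n F hF => ?_, ?_⟩
    · obtain ⟨p, hp⟩ := hC n (F.map φ.toEmbedding) (by
        intro y hy
        simp only [Finset.coe_map, Set.mem_image] at hy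
        obtain ⟨z, hz, rfl⟩ := hy
        exact hF hz)
      refine ⟨φ.symm p, fun q hq => ?_⟩
      have := (hle _ _).1 (hp _ (Finset.mem_map_of_mem φ.toEmbedding hq))
      simpa using this
    · rw [← Set.preimage_iUnion, hU, Set.preimage_univ]

theorem IsCentered.exists_le_of_finite {P : Type*} [PartialOrder P] {X s : Set P}
    (hX : IsCentered X) (hs : s.Finite) (hsX : s ⊆ X) : ∃ p, ∀ q ∈ s, p ≤ q := by
  obtain ⟨p, hp⟩ := hX hs.toFinset (by simpa using hsX)
  exact ⟨p, fun q hq => hp q (by simpa using hq)⟩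

/-! ### The witness poset -/

/-- `R δ n x` says that the first `n` values of `x` are admissible for `δ`; finitely many
requirements can always be extended simultaneously by one more value. -/
structure IsExtendible {W : Type*} (R : W → ℕ → (ℕ → ℕ) → Prop) : Prop where
  zero : ∀ δ x, R δ 0 x
  congr : ∀ {δ n x y}, (∀ i < n, x i = y i) → R δ n x → R δ n y
  mono : ∀ {δ m n x}, m ≤ n → R δ n x → R δ m x
  extend : ∀ (F : Finset W) n x, (∀ δ ∈ F, R δ n x) →
    ∃ k, ∀ δ ∈ F, R δ (n + 1) (Function.update x n k)

/-- The first `N` values of `x` are admissible for all members of `F`, and they are bounded by the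
agreement of the reals `r α`, `r β` up to the point where the ladders `c α`, `c β` split. -/
def IsWitness {W : Type*} (c : W → ℕ → W) (r : W → ℕ → Bool) (R : W → ℕ → (ℕ → ℕ) → Prop)
    (F : Finset W) (N : ℕ) (x : ℕ → ℕ) : Prop :=
  (∀ δ ∈ F, R δ N x) ∧ ∀ α ∈ F, ∀ β ∈ F, α ≠ β → ∀ n, (∀ i < n, c α i = c β i) →
    n < N ∧ ∀ j < x n, r α j = r β j

/-- The poset of finite sets of ordinals with a ladder that have a witness. -/
def WitnessPoset {W : Type*} [LinearOrder W] (c : W → ℕ → W) (r : W → ℕ → Bool)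
    (R : W → ℕ → (ℕ → ℕ) → Prop) : Type _ :=
  {F : Finset W // (∀ δ ∈ F, HasLadder δ) ∧ ∃ N x, IsWitness c r R F N x}

instance {W : Type*} [LinearOrder W] (c : W → ℕ → W) (r : W → ℕ → Bool)
    (R : W → ℕ → (ℕ → ℕ) → Prop) : PartialOrder (WitnessPoset c r R) where
  le F G := G.1 ⊆ F.1
  le_refl F := Finset.Subset.refl _
  le_trans _ _ _ h₁ h₂ := Finset.Subset.trans h₂ h₁
  le_antisymm _ _ h₁ h₂ := Subtype.ext (Finset.Subset.antisymm h₂ h₁)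

section Witness

variable {W : Type*} {c : W → ℕ → W} {r : W → ℕ → Bool} {R : W → ℕ → (ℕ → ℕ) → Prop}

theorem IsWitness.congr (hR : IsExtendible R) {F : Finset W} {N : ℕ} {x y : ℕ → ℕ}
    (h : IsWitness c r R F N x) (hxy : ∀ i < N, x i = y i) : IsWitness c r R F N y := by
  refine ⟨fun δ hδ => hR.congr hxy (h.1 δ hδ), fun α hα β hβ hne n hn => ?_⟩
  obtain ⟨h₁, h₂⟩ := h.2 α hα β hβ hne n hn
  exact ⟨h₁, by rwa [← hxy n h₁]⟩

theorem IsWitness.exists_of_le (hR : IsExtendible R) {F : Finset W} {N : ℕ} {x : ℕ → ℕ}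
    (h : IsWitness c r R F N x) {M : ℕ} (hNM : N ≤ M) : ∃ y, IsWitness c r R F M y := by
  induction M, hNM using Nat.le_induction with
  | base => exact ⟨x, h⟩
  | succ M _ ih =>
    obtain ⟨y, hy⟩ := ih
    obtain ⟨k, hk⟩ := hR.extend F M y hy.1
    refine ⟨_, hk, fun α hα β hβ hne n hn => ?_⟩
    obtain ⟨h₁, h₂⟩ := hy.2 α hα β hβ hne n hn
    exact ⟨h₁.trans M.lt_succ_self, by rwa [Function.update_of_ne h₁.ne]⟩

end Witness

theorem countable_setOf_finset_subset {α : Type*} {s : Set α} (hs : s.Countable) :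
    {F : Finset α | (F : Set α) ⊆ s}.Countable :=
  ((Set.countable_ofPred_finite_subset hs).preimage Finset.coe_injective).mono
    fun F hF => show (F : Set α).Finite ∧ (F : Set α) ⊆ s from ⟨F.finite_toSet, hF⟩

/-! ### Precaliber `ω₁` of the witness poset -/

section Code

variable {W : Type*} [LinearOrder W] {c : W → ℕ → W} {r : W → ℕ → Bool}
  {R : W → ℕ → (ℕ → ℕ) → Prop}

/-- The data pressed down in the proof that the witness poset has precaliber `ω₁`. -/
def IsCode (c : W → ℕ → W) (r : W → ℕ → Bool) (R : W → ℕ → (ℕ → ℕ) → Prop) (e : W → W → ℕ)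
    (F : Finset W) (γ η : W) (κ : List ℕ × ℕ × Finset (List ℕ × List Bool)) : Prop :=
  IsWitness c r R F κ.1.length (κ.1.getD · 0) ∧ (∀ n < κ.1.length, κ.1.getD n 0 ≤ κ.2.1) ∧
    ∃ ℓ : W → ℕ, (∀ β ∈ F, γ < β → (∀ i, c β i < γ ↔ i < ℓ β) ∧ ℓ β < κ.1.length ∧
      ∀ i < ℓ β, c β i < η) ∧
      κ.2.2 = (F.filter (γ < ·)).image fun β =>
        ((List.range (ℓ β)).map fun i => e η (c β i), (List.range κ.2.1).map (r β))

/-- A ladder of some `β > γ` has only finitely many terms below `γ`, so some `η < γ` bounds them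
all; the remaining data are countable. -/
theorem exists_isCode (hc : ∀ δ, HasLadder δ → IsLadder (c δ) δ) (hR : IsExtendible R)
    (e : W → W → ℕ) {F : Finset W} (hF : ∀ δ ∈ F, HasLadder δ) {N : ℕ} {x : ℕ → ℕ}
    (hx : IsWitness c r R F N x) {γ : W} (hγ : HasLadder γ) :
    ∃ η < γ, ∃ κ, IsCode c r R e F γ η κ := by
  have hℓ : ∀ β, ∃ ℓ, β ∈ F → γ < β → ∀ i, c β i < γ ↔ i < ℓ := by
    intro β
    by_cases hβ : β ∈ F ∧ γ < β
    · have hl := hc β (hF β hβ.1)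
      have hex : ∃ n, γ ≤ c β n := (hl.cofinal γ hβ.2).imp fun _ h => h.le
      classical
      refine ⟨Nat.find hex, fun _ _ i => ?_⟩
      rw [Nat.lt_find_iff]
      refine ⟨fun h m hm => ?_, fun h => ?_⟩
      · exact not_le.2 ((hl.strictMono.monotone hm).trans_lt h)
      · exact not_le.1 (h i le_rfl)
    · exact ⟨0, fun h h' => (hβ ⟨h, h'⟩).elim⟩
  choose ℓ hℓ using hℓ
  -- The witness is lengthened so that its length strictly exceeds every `ℓ β`.
  obtain ⟨y, hy⟩ := hx.exists_of_le hR (M := N + 1 + ∑ β ∈ F, ℓ β) (by omega)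
  set M := N + 1 + ∑ β ∈ F, ℓ β with hM
  obtain ⟨η, hη, hηb⟩ := hγ.exists_bound
    (s := ⋃ β ∈ F.filter (γ < ·), c β '' Set.Iio (ℓ β))
    (Set.Finite.biUnion (Finset.finite_toSet _) fun β _ => (Set.finite_Iio _).image _) (by
      intro a ha
      simp only [Set.mem_iUnion, Finset.mem_filter] at ha
      obtain ⟨β, ⟨hβ, hγβ⟩, i, hi, rfl⟩ := ha
      exact (hℓ β hβ hγβ i).2 hi)
  have hget : ∀ i < M, y i = ((List.range M).map y).getD i 0 := by
    intro i hi
    simp [List.getD, hi]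
  refine ⟨η, hη, ((List.range M).map y, ∑ n ∈ Finset.range M, y n,
    (F.filter (γ < ·)).image fun β => ((List.range (ℓ β)).map fun i => e η (c β i),
      (List.range (∑ n ∈ Finset.range M, y n)).map (r β))), ?_, ?_, ℓ, ?_, rfl⟩
  · simpa using hy.congr hR hget
  · intro n hn
    have hn' : n < M := by simpa using hn
    change ((List.range M).map y).getD n 0 ≤ _
    rw [← hget n hn']
    exact Finset.single_le_sum (f := y) (fun _ _ => Nat.zero_le _) (Finset.mem_range.2 hn')
  · intro β hβ hγβ
    refine ⟨hℓ β hβ hγβ, ?_, fun i hi => hηb _ ?_⟩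
    · have := Finset.single_le_sum (f := ℓ) (fun _ _ => Nat.zero_le _) hβ
      simp only [List.length_map, List.length_range]
      omega
    · simp only [Set.mem_iUnion]
      exact ⟨β, Finset.mem_filter.2 ⟨hβ, hγβ⟩, i, hi, rfl⟩

/-- Injectivity of `e η` recovers ladder traces from the code, so equal codes give `β` a twin in
`F`. -/
theorem IsCode.exists_similar {e : W → W → ℕ} (he : ∀ η, Set.InjOn (e η) (Set.Iio η))
    {F F' : Finset W} {γ γ' η : W} {κ} (h : IsCode c r R e F γ η κ)
    (h' : IsCode c r R e F' γ' η κ) {β : W} (hβ : β ∈ F') (hγβ : γ' < β) :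
    ∃ β' ∈ F, (∀ i, c β i < γ' → c β' i = c β i) ∧ 
      (∀ n, (∀ i < n, c β i < γ') → n < κ.1.length) ∧
      ∀ j < κ.2.1, r β' j = r β j := by
  obtain ⟨-, -, ℓ, hℓ, hT⟩ := h
  obtain ⟨-, -, ℓ', hℓ', hT'⟩ := h'
  have hmem := Finset.mem_image_of_mem (fun β =>
    ((List.range (ℓ' β)).map fun i => e η (c β i), (List.range κ.2.1).map (r β)))
    (Finset.mem_filter.2 ⟨hβ, hγβ⟩)
  rw [← hT', hT] at hmem
  obtain ⟨β', hβ', heq⟩ := Finset.mem_image.1 hmem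
  obtain ⟨hβ', hγβ'⟩ := Finset.mem_filter.1 hβ'
  obtain ⟨heq₁, heq₂⟩ := Prod.mk.inj heq
  have hlen : ℓ β' = ℓ' β := by simpa using congrArg List.length heq₁
  obtain ⟨h₁, h₂, h₃⟩ := hℓ β' hβ' hγβ'
  obtain ⟨h₁', h₂', h₃'⟩ := hℓ' β hβ hγβ
  rw [hlen, List.map_inj_left] at heq₁
  rw [List.map_inj_left] at heq₂
  refine ⟨β', hβ', fun i hi => ?_, fun n hn => ?_, fun j hj => heq₂ j (List.mem_range.2 hj)⟩
  · have hi' := (h₁' i).1 hi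
    exact he η (h₃ i (hlen ▸ hi')) (h₃' i hi') (heq₁ i (List.mem_range.2 hi'))
  · refine lt_of_le_of_lt ?_ h₂'
    by_contra! hlt
    exact lt_irrefl _ ((h₁' _).1 (hn _ hlt))

end Code

section Precaliber

variable {W : Type*} [LinearOrder W] [WellFoundedLT W] [Uncountable W] [CountableSegments W]
  {c : W → ℕ → W} {r : W → ℕ → Bool} {R : W → ℕ → (ℕ → ℕ) → Prop}

/-- A `Δ`-system lemma. -/
theorem exists_root {X : Set (Finset W)} (hX : ¬ X.Countable) :
    ∃ ρ : Finset W, ∀ b, ∃ F ∈ X, ρ ⊆ F ∧ (∀ α ∈ F, α ∈ ρ ∨ b < α) ∧ ∃ a ∈ F, b < a := by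
  have h0 : ∀ b, ∃ F ∈ X, ∃ a ∈ F, b < a := by
    intro b
    by_contra! hcon
    exact hX ((countable_setOf_finset_subset (CountableSegments.countable_Iic b)).mono
      fun F hF a ha => hcon F hF a ha)
  choose G hGX a haG hab using h0
  obtain ⟨e, he⟩ := exists_injOn_Iio W
  -- The trace of `G γ` below `γ` is pressed down, coded by a finite set of naturals; it becomes the
  -- root.
  obtain ⟨η, κ, hE⟩ := pressing_down (W := W) id
    (fun γ η (κ : Finset ℕ) => (∀ α ∈ (G γ).filter (· < γ), α < η) ∧
      ((G γ).filter (· < γ)).image (e η) = κ) (fun γ hγ => by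
        obtain ⟨η, hη, h⟩ := hγ.exists_bound ((G γ).filter (· < γ)).finite_toSet
          (fun a ha => (Finset.mem_filter.1 ha).2)
        exact ⟨η, hη, _, h, rfl⟩)
  obtain ⟨b₀⟩ : Nonempty W := inferInstance
  obtain ⟨γ₀, -, -, -, h₀, hκ₀⟩ := hE b₀
  refine ⟨(G γ₀).filter (· < γ₀), fun b => ?_⟩
  obtain ⟨γ, hbγ, -, -, h, hκ⟩ := hE b
  have heq : (G γ).filter (· < γ) = (G γ₀).filter (· < γ₀) := by
    apply Finset.coe_injective
    refine ((he η).image_eq_image_iff (fun α hα => h α hα) (fun α hα => h₀ α hα)).1 ?_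
    rw [← Finset.coe_image, ← Finset.coe_image, hκ, hκ₀]
  refine ⟨G γ, hGX γ, heq ▸ Finset.filter_subset _ _, fun α hα => ?_, a γ, haG γ, hbγ.trans (hab γ)⟩
  rw [← heq, Finset.mem_filter]
  rcases lt_or_ge α γ with h' | h'
  · exact Or.inl ⟨hα, h'⟩
  · exact Or.inr (hbγ.trans_le h')

/-- Uncountably many conditions share a code, and its witness serves all their finite unions. For `γ
< γ'`, closure of `γ'` under `m` puts the ladder of `α ∈ F γ` below `γ'`, so its agreement with the
ladder of `β ∈ F γ'`, `β > γ'`, is already seen by the twin of `β` in `F γ`. -/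
theorem hasPrecaliberOmegaOne_witnessPoset (hc : ∀ δ, HasLadder δ → IsLadder (c δ) δ)
    (hR : IsExtendible R) : HasPrecaliberOmegaOne (WitnessPoset c r R) := by
  intro X hX
  obtain ⟨ρ, hρ⟩ := exists_root (X := Subtype.val '' X) fun h =>
    hX (Set.countable_of_injective_of_countable_image Subtype.val_injective.injOn h)
  have hρ' : ∀ b, ∃ F ∈ X, ρ ⊆ F.1 ∧ (∀ α ∈ F.1, α ∈ ρ ∨ b < α) ∧ ∃ a ∈ F.1, b < a := by
    intro b
    obtain ⟨_, ⟨F, hF, rfl⟩, h⟩ := hρ b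
    exact ⟨F, hF, h⟩
  choose F hFX hρF htail a haF hba using hρ'
  have hbound : ∀ β, ∃ m, ∀ α ∈ (F β).1, α < m := fun β =>
    exists_gt_of_countable (F β).1.countable_toSet
  choose m hm using hbound
  obtain ⟨e, he⟩ := exists_injOn_Iio W
  obtain ⟨η, κ, hE⟩ := pressing_down m (fun γ η κ => IsCode c r R e (F γ).1 γ η κ)
    (fun γ hγ => by
      obtain ⟨N, x, hx⟩ := (F γ).2.2
      exact exists_isCode hc hR e (F γ).2.1 hx hγ)
  let E : Set W := {γ | (∀ β < γ, m β < γ) ∧ IsCode c r R e (F γ).1 γ η κ}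
  have key : ∀ γ ∈ E, ∀ γ' ∈ E, γ ≤ γ' → ∀ α ∈ (F γ).1, ∀ β ∈ (F γ').1, α ≠ β →
      ∀ n, (∀ i < n, c α i = c β i) →
        n < κ.1.length ∧ ∀ j < κ.1.getD n 0, r α j = r β j := by
    intro γ hγ γ' hγ' hle α hα β hβ hne n hn
    rcases hle.eq_or_lt with rfl | hlt
    · exact hγ.2.1.2 α hα β hβ hne n hn
    rcases htail γ' β hβ with hβρ | hβγ'
    · exact hγ.2.1.2 α hα β (hρF γ hβρ) hne n hn
    obtain ⟨β', hβ', h₁, h₂, h₃⟩ := hγ.2.exists_similar he hγ'.2 hβ hβγ'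
    have hlow : ∀ i < n, c β i < γ' := fun i hi => by
      rw [← hn i hi]
      exact ((hc α ((F γ).2.1 α hα)).lt i).trans ((hm γ α hα).trans (hγ'.1 γ hlt))
    have hnN : n < κ.1.length := h₂ n hlow
    refine ⟨hnN, ?_⟩
    rcases eq_or_ne α β' with rfl | hne'
    · exact fun j hj => h₃ j (hj.trans_le (hγ.2.2.1 n hnN))
    · intro j hj
      rw [(hγ.2.1.2 α hα β' hβ' hne' n fun i hi => by rw [h₁ i (hlow i hi), hn i hi]).2 j hj]
      exact h₃ j (hj.trans_le (hγ.2.2.1 n hnN))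
  refine ⟨F '' E, ?_, fun hcount => ?_, fun 𝒢 h𝒢 => ?_⟩
  · rintro _ ⟨γ, -, rfl⟩
    exact hFX γ
  · obtain ⟨b, hb⟩ := exists_gt_of_countable
      (hcount.biUnion fun G _ => G.1.countable_toSet)
    obtain ⟨γ, hbγ, -, hγ, hcode⟩ := hE b
    exact ((hb (a γ) (Set.mem_biUnion ⟨γ, ⟨hγ, hcode⟩, rfl⟩ (haF γ))).trans
      (hbγ.trans (hba γ))).false
  · have hmem : ∀ α ∈ 𝒢.biUnion (·.1), ∃ γ ∈ E, α ∈ (F γ).1 := by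
      intro α hα
      obtain ⟨G, hG, hα⟩ := Finset.mem_biUnion.1 hα
      obtain ⟨γ, hγ, rfl⟩ := h𝒢 hG
      exact ⟨γ, hγ, hα⟩
    refine ⟨⟨𝒢.biUnion (·.1), fun δ hδ => ?_, κ.1.length, (κ.1.getD · 0), fun δ hδ => ?_, ?_⟩,
      fun G hG => Finset.subset_biUnion_of_mem (fun G : WitnessPoset c r R => G.1) hG⟩
    · obtain ⟨γ, -, hγ⟩ := hmem δ hδ
      exact (F γ).2.1 δ hγ
    · obtain ⟨γ, hγE, hγ⟩ := hmem δ hδ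
      exact hγE.2.1.1 δ hγ
    · intro α hα β hβ hne n hn
      obtain ⟨γ, hγ, hα⟩ := hmem α hα
      obtain ⟨γ', hγ', hβ⟩ := hmem β hβ
      rcases le_total γ γ' with hle | hle
      · exact key γ hγ γ' hγ' hle α hα β hβ hne n hn
      · obtain ⟨h₁, h₂⟩ := key γ' hγ' γ hγ hle β hβ α hα hne.symm n fun i hi => (hn i hi).symm
        exact ⟨h₁, fun j hj => (h₂ j hj).symm⟩

end Precaliber

/-! ### A common branch by compactness -/

theorem IsExtendible.isClosed {W : Type*} {R : W → ℕ → (ℕ → ℕ) → Prop}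
    (hR : IsExtendible R) (δ : W) (n : ℕ) : IsClosed {x | R δ n x} := by
  have : {x | R δ n x} = (fun (x : ℕ → ℕ) (i : Fin n) => x i) ⁻¹'
      ((fun (x : ℕ → ℕ) (i : Fin n) => x i) '' {x | R δ n x}) := by
    refine (Set.subset_preimage_image _ _).antisymm ?_
    rintro x ⟨y, hy, hxy⟩
    exact hR.congr (fun i hi => congrFun hxy ⟨i, hi⟩) hy
  rw [this]
  exact (isClosed_discrete _).preimage (by fun_prop)

section Branch

variable {W : Type*} [LinearOrder W] [WellFoundedLT W] [Uncountable W] [CountableSegments W]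
  {c : W → ℕ → W} {r : W → ℕ → Bool} {R : W → ℕ → (ℕ → ℕ) → Prop}

/-- If the ordinals with a ladder are covered by countably many sets, one of them is unbounded
and the ladders of its members agree arbitrarily long. -/
theorem exists_unbounded_agreeing (hc : ∀ δ, HasLadder δ → IsLadder (c δ) δ) (S : ℕ → Set W)
    (hS : ∀ δ, HasLadder δ → ∃ m, δ ∈ S m) :
    ∃ m, (∀ b, ∃ δ ∈ S m, b < δ) ∧
      ∀ n, ∃ α ∈ S m, ∃ β ∈ S m, α ≠ β ∧ ∀ i < n, c α i = c β i := by
  have hcon : ¬ ∀ m, ∃ n, (∀ b, ∃ δ ∈ S m, b < δ) →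
      ∀ α ∈ S m, ∀ β ∈ S m, (∀ i < n, c α i = c β i) → α = β := by
    intro hcon
    choose n hn using hcon
    obtain ⟨e, he⟩ := exists_injOn_Iio W
    -- Pressing down `m` together with the first `n m` ladder values gives an unbounded `S m` with
    -- two distinct members agreeing that long.
    obtain ⟨η, κ, hE⟩ := pressing_down (W := W) id
      (fun γ η (κ : ℕ × List ℕ) => γ ∈ S κ.1 ∧ (∀ i < n κ.1, c γ i < η) ∧
        κ.2 = (List.range (n κ.1)).map fun i => e η (c γ i)) (fun γ hγ => by
          obtain ⟨m, hm⟩ := hS γ hγ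
          exact ⟨c γ (n m), (hc γ hγ).lt _,
            (m, (List.range (n m)).map fun i => e (c γ (n m)) (c γ i)), hm,
            fun i hi => (hc γ hγ).strictMono hi, rfl⟩)
    obtain ⟨b₀⟩ : Nonempty W := inferInstance
    obtain ⟨γ, -, -, -, hγS, hγη, hγ⟩ := hE b₀
    obtain ⟨γ', hlt, -, -, hγS', hγη', hγ'⟩ := hE γ
    refine hlt.ne (hn κ.1 (fun b => ?_) γ hγS γ' hγS' fun i hi => ?_)
    · obtain ⟨δ, hbδ, -, -, hδ, -⟩ := hE b
      exact ⟨δ, hδ, hbδ⟩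
    · rw [hγ, List.map_inj_left] at hγ'
      exact he η (hγη i hi) (hγη' i hi) (hγ' i (List.mem_range.2 hi))
  push Not at hcon
  obtain ⟨m, hm⟩ := hcon
  refine ⟨m, (hm 0).1, fun n => ?_⟩
  obtain ⟨α, hα, β, hβ, h, hne⟩ := (hm n).2
  exact ⟨α, hα, β, hβ, hne, h⟩

/-- If the witness poset is `σ`-centered, uncountably many requirements have a common branch. -/
theorem exists_branch_of_isSigmaCentered (hc : ∀ δ, HasLadder δ → IsLadder (c δ) δ)
    (hr : Function.Injective r) (hR : IsExtendible R)
    (hσ : IsSigmaCentered (WitnessPoset c r R)) :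
    ∃ x : ℕ → ℕ, ∀ b, ∃ δ, b < δ ∧ ∀ n, R δ n x := by
  obtain ⟨C, hC, hU⟩ := hσ
  let q : ∀ δ, HasLadder δ → WitnessPoset c r R := fun δ hδ =>
    ⟨{δ}, by simpa using hδ, 0, fun _ => 0, by simpa using hR.zero δ _, by
      intro α hα β hβ hne
      rw [Finset.mem_singleton] at hα hβ
      exact (hne (hα.trans hβ.symm)).elim⟩
  obtain ⟨m, hunb, hag⟩ := exists_unbounded_agreeing hc (fun m => {δ | ∃ hδ, q δ hδ ∈ C m})
    (fun δ hδ => by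
      obtain ⟨m, hm⟩ := Set.mem_iUnion.1 (hU ▸ Set.mem_univ (q δ hδ))
      exact ⟨m, hδ, hm⟩)
  set S : Set W := {δ | ∃ hδ, q δ hδ ∈ C m} with hS
  choose α hα β hβ hne hαβ using hag
  have hB : ∀ n, ∃ j, r (α n) j ≠ r (β n) j := fun n => Function.ne_iff.1 (hr.ne (hne n))
  choose B hB using hB
  have hfin : ∀ (F : Set W), F.Finite → F ⊆ S → ∀ N, ∃ x, (∀ δ ∈ F, R δ N x) ∧ ∀ n, x n ≤ B n := by
    intro F hF hFS N
    -- Adding the pairs `α n`, `β n` for `n ≤ N` forces the witness to be longer than `N` and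
    -- bounded by `B` there.
    have hF' : (F ∪ α '' Set.Iic N ∪ β '' Set.Iic N) ⊆ S := by
      rintro δ ((hδ | ⟨n, -, rfl⟩) | ⟨n, -, rfl⟩)
      exacts [hFS hδ, hα n, hβ n]
    have hfin : (F ∪ α '' Set.Iic N ∪ β '' Set.Iic N).Finite :=
      (hF.union ((Set.finite_Iic N).image α)).union ((Set.finite_Iic N).image β)
    obtain ⟨⟨G, hGl, M, x, hx⟩, hG⟩ := (hC m).exists_le_of_finite
      (s := {p | p ∈ C m ∧ ∃ δ ∈ F ∪ α '' Set.Iic N ∪ β '' Set.Iic N, p.1 = {δ}})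
      ((hfin.image fun δ => ({δ} : Finset W)).preimage Subtype.val_injective.injOn |>.subset (by
        rintro p ⟨-, δ, hδ, hp⟩
        exact ⟨δ, hδ, hp.symm⟩)) (fun p hp => hp.1)
    have hmem : ∀ δ ∈ F ∪ α '' Set.Iic N ∪ β '' Set.Iic N, δ ∈ G := by
      intro δ hδ
      obtain ⟨hl, hq⟩ := hF' hδ
      exact hG (q δ hl) ⟨hq, δ, hδ, rfl⟩ (Finset.mem_singleton_self δ)
    have hxB : ∀ n ≤ N, n < M ∧ x n ≤ B n := by
      intro n hn
      obtain ⟨h₁, h₂⟩ := hx.2 (α n) (hmem _ (Or.inl (Or.inr ⟨n, hn, rfl⟩))) (β n)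
        (hmem _ (Or.inr ⟨n, hn, rfl⟩)) (hne n) n (hαβ n)
      exact ⟨h₁, not_lt.1 fun h => hB n (h₂ _ h)⟩
    -- `R δ N` ignores the values beyond `N`; zero keeps them below `B`.
    refine ⟨fun n => if n ≤ N then x n else 0, fun δ hδ => ?_, fun n => ?_⟩
    · refine hR.congr (x := x) (fun i hi => (if_pos hi.le).symm) ?_
      exact hR.mono (hxB N le_rfl).1.le (hx.1 δ (hmem δ (Or.inl (Or.inl hδ))))
    · dsimp only
      split_ifs with h
      exacts [(hxB n h).2, Nat.zero_le _]
  obtain ⟨x, -, hx⟩ := (isCompact_univ_pi fun n => (Set.finite_Iic (B n)).isCompact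
    ).inter_iInter_nonempty (fun p : S × ℕ => {x | R p.1 p.2 x}) (fun p => hR.isClosed _ _) (by
      intro u
      obtain ⟨x, hx, hxB⟩ := hfin ((fun p : S × ℕ => (p.1 : W)) '' u)
        (u.finite_toSet.image _) (by rintro _ ⟨p, -, rfl⟩; exact p.1.2) (u.sup Prod.snd)
      refine ⟨x, fun n _ => hxB n, Set.mem_iInter₂.2 fun p hp => ?_⟩
      exact hR.mono (Finset.le_sup (f := Prod.snd) hp) (hx _ ⟨p, hp, rfl⟩))
  refine ⟨x, fun b => ?_⟩
  obtain ⟨δ, hδ, hb⟩ := hunb b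
  exact ⟨δ, hb, fun n => Set.mem_iInter.1 hx (⟨δ, hδ⟩, n)⟩

end Branch

theorem PrecaliberImpliesSigmaCentered.exists_branch (h : PrecaliberImpliesSigmaCentered.{u})
    {W : Type v} [LinearOrder W] [WellFoundedLT W] [Uncountable W] [CountableSegments W]
    (hW : #W = ℵ₁) {R : W → ℕ → (ℕ → ℕ) → Prop} (hR : IsExtendible R) :
    ∃ x : ℕ → ℕ, ∀ b, ∃ δ, b < δ ∧ ∀ n, R δ n x := by
  classical
  have hc : ∀ δ : W, ∃ c : ℕ → W, HasLadder δ → IsLadder c δ := by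
    intro δ
    by_cases hδ : HasLadder δ
    · exact hδ.imp fun _ h _ => h
    · exact ⟨fun _ => δ, fun h => (hδ h).elim⟩
  choose c hc using hc
  obtain ⟨⟨r, hr⟩⟩ : Nonempty (W ↪ (ℕ → Bool)) := by
    rw [← Cardinal.lift_mk_le', hW]
    simpa using Cardinal.aleph_one_le_continuum
  have : Nonempty (WitnessPoset c r R) :=
    ⟨⟨∅, by simp, 0, fun _ => 0, by simp [IsWitness]⟩⟩
  refine exists_branch_of_isSigmaCentered hc hr hR
    (h.isSigmaCentered ?_ (hasPrecaliberOmegaOne_witnessPoset hc hR))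
  have : Infinite W := inferInstance
  exact (Cardinal.mk_subtype_le _).trans (by rw [Cardinal.mk_finset_of_infinite, hW])

/-! ### Descending chains and compatible choices -/

section Chain

variable {P : Type*} [PartialOrder P] [Nonempty P]

/-- A decreasing chain through `C (x k), C (x (k + 1)), …` that starts in `D`, as long as one
exists. -/
noncomputable def chain (C : ℕ → Set P) (D : Set P) (x : ℕ → ℕ) (k : ℕ) : ℕ → P
  | 0 => Classical.epsilon fun p => p ∈ D ∧ p ∈ C (x k)
  | j + 1 => Classical.epsilon fun p => p ≤ chain C D x k j ∧ p ∈ C (x (k + (j + 1)))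

/-- The `j`-th step in the construction of `chain` succeeds. -/
def ChainStep (C : ℕ → Set P) (D : Set P) (x : ℕ → ℕ) (k : ℕ) : ℕ → Prop
  | 0 => chain C D x k 0 ∈ D ∧ chain C D x k 0 ∈ C (x k)
  | j + 1 => chain C D x k (j + 1) ≤ chain C D x k j ∧ chain C D x k (j + 1) ∈ C (x (k + (j + 1)))

variable {C : ℕ → Set P} {D : Set P} {x y : ℕ → ℕ} {k j : ℕ}

theorem chain_congr (h : ∀ i ≤ k + j, x i = y i) : chain C D x k j = chain C D y k j := by
  induction j with
  | zero => rw [chain, chain, h k le_rfl]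
  | succ j ih => rw [chain, chain, ih fun i hi => h i (by omega), h _ le_rfl]

theorem chainStep_congr (h : ∀ i ≤ k + j, x i = y i) :
    ChainStep C D x k j ↔ ChainStep C D y k j := by
  cases j with
  | zero => rw [ChainStep, ChainStep, chain_congr h, h k le_rfl]
  | succ j =>
    rw [ChainStep, ChainStep, chain_congr h, h _ le_rfl,
      chain_congr (j := j) fun i hi => h i (by omega)]

theorem ChainStep.mem (h : ChainStep C D x k j) : chain C D x k j ∈ C (x (k + j)) := by
  cases j with
  | zero => exact h.2
  | succ j => exact h.2

theorem chainStep_zero (h : ∃ p ∈ D, p ∈ C (x k)) : ChainStep C D x k 0 := by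
  rw [ChainStep, chain]
  exact Classical.epsilon_spec (p := fun p => p ∈ D ∧ p ∈ C (x k)) h

theorem chainStep_succ (h : ∃ p ≤ chain C D x k j, p ∈ C (x (k + (j + 1)))) :
    ChainStep C D x k (j + 1) := by
  rw [ChainStep, chain]
  exact Classical.epsilon_spec
    (p := fun p => p ≤ chain C D x k j ∧ p ∈ C (x (k + (j + 1)))) h

theorem chain_antitone (h : ∀ j, ChainStep C D x k j) : Antitone (chain C D x k) :=
  antitone_nat_of_succ_le fun j => (h (j + 1)).1

end Chain

theorem exists_le_of_isForcingDense {P ι : Type*} [PartialOrder P] {D : ι → Set P} {s : Set ι}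
    (hs : s.Finite) (hD : ∀ i ∈ s, IsForcingDense (D i)) (p : P) :
    ∃ q ≤ p, ∀ i ∈ s, ∃ d ∈ D i, q ≤ d := by
  induction s, hs using Set.Finite.induction_on with
  | empty => exact ⟨p, le_rfl, by simp⟩
  | @insert i s _ _ ih =>
    obtain ⟨q, hqp, hq⟩ := ih fun j hj => hD j (Set.mem_insert_of_mem _ hj)
    obtain ⟨d, hd, hdq⟩ := hD i (Set.mem_insert _ _) q
    refine ⟨d, hdq.trans hqp, ?_⟩
    rintro j (rfl | hj)
    · exact ⟨d, hd, le_rfl⟩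
    · obtain ⟨d', hd', hqd'⟩ := hq j hj
      exact ⟨d', hd', hdq.trans hqd'⟩

theorem IsSigmaCentered.exists_upward_closed {P : Type*} [PartialOrder P] (h : IsSigmaCentered P) :
    ∃ C : ℕ → Set P, (∀ n, IsCentered (C n)) ∧ (∀ p, ∃ n, p ∈ C n) ∧
      ∀ n p q, p ≤ q → p ∈ C n → q ∈ C n := by
  obtain ⟨C, hC, hU⟩ := h
  refine ⟨fun n => upperClosure (C n), fun n F hF => ?_, fun p => ?_, fun n p q hpq hp =>
    (upperClosure (C n)).upper hpq hp⟩
  · have : ∀ q, ∃ p, q ∈ F → p ∈ C n ∧ p ≤ q := fun q => by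
      by_cases hq : q ∈ F
      · obtain ⟨p, hp, hpq⟩ := hF hq
        exact ⟨p, fun _ => ⟨hp, hpq⟩⟩
      · exact ⟨q, fun h => (hq h).elim⟩
    choose f hf using this
    obtain ⟨p, hp⟩ := (hC n).exists_le_of_finite (F.finite_toSet.image f) (by
      rintro _ ⟨q, hq, rfl⟩
      exact (hf q hq).1)
    exact ⟨p, fun q hq => (hp _ ⟨q, hq, rfl⟩).trans (hf q hq).2⟩
  · obtain ⟨n, hn⟩ := Set.mem_iUnion.1 (hU ▸ Set.mem_univ p)
    exact ⟨n, subset_upperClosure hn⟩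

/-- Pairwise compatible elements of given dense subsets of a `σ`-centered poset. -/
theorem PrecaliberImpliesSigmaCentered.exists_compatible (h : PrecaliberImpliesSigmaCentered.{u})
    {W : Type v} [LinearOrder W] [WellFoundedLT W] [Uncountable W] [CountableSegments W]
    (hW : #W = ℵ₁) {P : Type*} [PartialOrder P] [Nonempty P] (hσ : IsSigmaCentered P)
    {D : W → Set P} (hD : ∀ α, IsForcingDense (D α)) :
    ∃ g : W → P, (∀ α, g α ∈ D α) ∧ ∀ α β, ∃ p, p ≤ g α ∧ p ≤ g β := by
  obtain ⟨C, hC, hU, hup⟩ := hσ.exists_upward_closed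
  obtain ⟨e, he⟩ := exists_injOn_Iio W
  let R : W → ℕ → (ℕ → ℕ) → Prop := fun δ N x =>
    ∀ α < δ, ∀ j, e δ α + j < N → ChainStep C (D α) x (e δ α) j
  have hR : IsExtendible R := by
    refine ⟨fun δ x α _ j hj => absurd hj (Nat.not_lt_zero _), ?_, ?_, ?_⟩
    · intro δ n x y hxy hx α hα j hj
      exact (chainStep_congr fun i hi => hxy i (by omega)).1 (hx α hα j hj)
    · intro δ m n x hmn hx α hα j hj
      exact hx α hα j (hj.trans_le hmn)
    · intro F n x hx
      -- Only finitely many chains have started by position `n`, because `e δ` is injective below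
      -- `δ`.
      have hact : {p : W × W | p.1 ∈ F ∧ p.2 < p.1 ∧ e p.1 p.2 ≤ n}.Finite := by
        refine (F.finite_toSet.biUnion (t := fun δ => Prod.mk δ '' {α | α < δ ∧ e δ α ≤ n})
          fun δ _ => Set.Finite.image _ ?_).subset ?_
        · exact Set.Finite.of_finite_image ((Set.finite_Iic n).subset
            (by rintro _ ⟨α, hα, rfl⟩; exact hα.2)) ((he δ).mono fun α hα => hα.1)
        · rintro ⟨δ, α⟩ ⟨hδ, hα⟩
          exact Set.mem_biUnion hδ ⟨α, hα, rfl⟩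
      have hlow : ∃ p, ∀ δ ∈ F, ∀ α < δ, ∀ j, e δ α + j + 1 = n →
          p ≤ chain C (D α) x (e δ α) j := by
        -- All running chains currently end in `C (x (n - 1))`. For `n = 0` none is running, so the
        -- truncated index is harmless.
        obtain ⟨p, hp⟩ := (hC (x (n - 1))).exists_le_of_finite
          (s := {p | ∃ δ ∈ F, ∃ α < δ, ∃ j, e δ α + j + 1 = n ∧
            chain C (D α) x (e δ α) j = p})
          ((hact.image fun p : W × W => chain C (D p.2) x (e p.1 p.2) (n - 1 - e p.1 p.2)).subset
            (by
              rintro _ ⟨δ, hδ, α, hα, j, hj, rfl⟩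
              refine ⟨(δ, α), ⟨hδ, hα, by dsimp only; omega⟩, ?_⟩
              dsimp only
              congr 1
              omega))
          (by
            rintro _ ⟨δ, hδ, α, hα, j, hj, rfl⟩
            have := (hx δ hδ α hα j (by omega)).mem
            rwa [show e δ α + j = n - 1 by omega] at this)
        exact ⟨p, fun δ hδ α hα j hj => hp _ ⟨δ, hδ, α, hα, j, hj, rfl⟩⟩
      obtain ⟨p, hp⟩ := hlow
      -- `q` continues every running chain and lies below a starting point for each new one; upward
      -- closure puts these points in `C m` too.
      obtain ⟨q, hqp, hq⟩ := exists_le_of_isForcingDense (D := fun p : W × W => D p.2) hact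
        (fun _ _ => hD _) p
      obtain ⟨m, hm⟩ := hU q
      refine ⟨m, fun δ hδ α hα j hj => ?_⟩
      rcases Nat.lt_succ_iff_lt_or_eq.1 hj with hlt | heq
      · refine (chainStep_congr fun i hi => ?_).1 (hx δ hδ α hα j hlt)
        rw [Function.update_of_ne (by omega)]
      · cases j with
        | zero =>
          obtain ⟨d, hd, hqd⟩ := hq (δ, α) ⟨hδ, hα, heq.le⟩
          refine chainStep_zero ⟨d, hd, ?_⟩
          rw [show e δ α = n from heq, Function.update_self]
          exact hup m q d hqd hm
        | succ j =>
          refine chainStep_succ ⟨q, ?_, ?_⟩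
          · rw [chain_congr (y := x) fun i hi => Function.update_of_ne (by omega) _ _]
            exact hqp.trans (hp δ hδ α hα j heq)
          · rwa [heq, Function.update_self]
  obtain ⟨x, hx⟩ := h.exists_branch hW hR
  choose δ hδ hx using hx
  let k : W → ℕ := fun α => e (δ α) α
  have hstep : ∀ α j, ChainStep C (D α) x (k α) j := fun α j =>
    hx α (k α + j + 1) α (hδ α) j (Nat.lt_succ_self _)
  refine ⟨fun α => chain C (D α) x (k α) 0, fun α => (hstep α 0).1, fun α β => ?_⟩
  have hα := (hstep α (k β)).mem
  have hβ := (hstep β (k α)).mem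
  -- Both chains are now at position `k α + k β`, hence in the same centered set.
  rw [add_comm] at hβ
  obtain ⟨p, hp⟩ := (hC (x (k α + k β))).exists_le_of_finite
    (Set.toFinite {chain C (D α) x (k α) (k β), chain C (D β) x (k β) (k α)})
    (by rintro _ (rfl | rfl) <;> assumption)
  exact ⟨p, (hp _ (Or.inl rfl)).trans (chain_antitone (hstep α) (Nat.zero_le _)),
    (hp _ (Or.inr rfl)).trans (chain_antitone (hstep β) (Nat.zero_le _))⟩

/-! ### Reduction to size `ℵ₁` and the filter -/

/-- A subset of size at most `ℵ₁` closed under witnesses of density and under lower bounds of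
finite sets. -/
theorem exists_closed_subset {P : Type v} [PartialOrder P] [Nonempty P] {𝒟 : Set (Set P)}
    (h𝒟 : #𝒟 ≤ ℵ₁) (hD : ∀ D ∈ 𝒟, IsForcingDense D) :
    ∃ A : Set P, A.Nonempty ∧ #A ≤ ℵ₁ ∧ (∀ D ∈ 𝒟, ∀ p ∈ A, ∃ d ∈ D, d ∈ A ∧ d ≤ p) ∧
      ∀ F : Finset P, (F : Set P) ⊆ A → (∃ p, ∀ q ∈ F, p ≤ q) → ∃ p ∈ A, ∀ q ∈ F, p ≤ q := by
  classical
  have hw : ∀ D : 𝒟, ∀ p, ∃ d ∈ D.1, d ≤ p := fun D => hD D.1 D.2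
  choose w hwD hwp using hw
  have hl : ∀ F : Finset P, ∃ p, (∃ p, ∀ q ∈ F, p ≤ q) → ∀ q ∈ F, p ≤ q := by
    intro F
    by_cases hF : ∃ p, ∀ q ∈ F, p ≤ q
    · exact hF.imp fun _ h _ => h
    · exact ⟨Classical.arbitrary P, fun h => (hF h).elim⟩
  choose l hl using hl
  let next : Set P → Set P := fun s => s ∪ (Set.range fun p : 𝒟 × s => w p.1 p.2) ∪
    Set.range fun F : Finset s => l (F.map (Function.Embedding.subtype _))
  have hnext : ∀ s : Set P, #s ≤ ℵ₁ → #(next s) ≤ ℵ₁ := by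
    intro s hs
    have hinf := Cardinal.aleph0_le_aleph 1
    refine (Cardinal.mk_union_le _ _).trans (Cardinal.add_le_of_le hinf
      ((Cardinal.mk_union_le _ _).trans (Cardinal.add_le_of_le hinf hs ?_)) ?_)
    · refine Cardinal.mk_range_le.trans ?_
      rw [Cardinal.mk_prod, Cardinal.lift_id, Cardinal.lift_id]
      exact Cardinal.mul_le_of_le hinf h𝒟 hs
    · refine Cardinal.mk_range_le.trans ?_
      rcases finite_or_infinite s with h | h
      · exact ((Cardinal.mk_lt_aleph0).le.trans hinf)
      · rwa [Cardinal.mk_finset_of_infinite]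
  let A : ℕ → Set P := fun n => next^[n] {Classical.arbitrary P}
  have hA : ∀ n, A (n + 1) = next (A n) := fun n => Function.iterate_succ_apply' next n _
  have hmono : Monotone A := monotone_nat_of_le_succ fun n => by
    rw [hA]
    exact Set.subset_union_left.trans Set.subset_union_left
  have hcard : ∀ n, #(A n) ≤ ℵ₁ := by
    intro n
    induction n with
    | zero =>
      exact (Cardinal.mk_singleton _).le.trans (Cardinal.one_le_aleph0.trans
        (Cardinal.aleph0_le_aleph 1))
    | succ n ih => rw [hA]; exact hnext _ ih
  refine ⟨⋃ n, A n, ⟨Classical.arbitrary P, Set.mem_iUnion.2 ⟨0, rfl⟩⟩, ?_, ?_, ?_⟩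
  · have := Cardinal.mk_iUnion_le_lift A
    refine (by simpa using this : #(⋃ n, A n) ≤ ℵ₀ * ⨆ n, #(A n)).trans
      (Cardinal.mul_le_of_le (Cardinal.aleph0_le_aleph 1) (Cardinal.aleph0_le_aleph 1)
        (ciSup_le' hcard))
  · intro D hD p hp
    obtain ⟨n, hn⟩ := Set.mem_iUnion.1 hp
    refine ⟨w ⟨D, hD⟩ p, hwD ⟨D, hD⟩ p, Set.mem_iUnion.2 ⟨n + 1, ?_⟩, hwp _ _⟩
    rw [hA]
    exact Or.inl (Or.inr ⟨(⟨D, hD⟩, ⟨p, hn⟩), rfl⟩)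
  · intro F hF hbd
    obtain ⟨n, hn⟩ : ∃ n, (F : Set P) ⊆ A n :=
      Directed.exists_mem_subset_of_finset_subset_biUnion hmono.directed_le hF
    refine ⟨l F, Set.mem_iUnion.2 ⟨n + 1, ?_⟩, hl F hbd⟩
    rw [hA]
    refine Or.inr ⟨F.subtype (· ∈ A n), ?_⟩
    dsimp only
    rw [Finset.subtype_map_of_mem fun p hp => hn hp]

theorem theorem1p5 (h : PrecaliberImpliesSigmaCentered.{u}) :
    MartinAxiomPrecaliber.{v} := by
  intro P _ _ hpre 𝒟 h𝒟 hD
  obtain ⟨A, hAne, hA, hAD, hAF⟩ := exists_closed_subset h𝒟 hD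
  have : Nonempty A := hAne.to_subtype
  have hpreA : HasPrecaliberOmegaOne A := by
    intro X hX
    obtain ⟨Y, hYX, hY, hYc⟩ := hpre (Subtype.val '' X) fun hc =>
      hX (Set.countable_of_injective_of_countable_image Subtype.val_injective.injOn hc)
    refine ⟨Subtype.val ⁻¹' Y, fun y hy => ?_, fun hc => hY ?_, fun F hF => ?_⟩
    · obtain ⟨z, hz, hzy⟩ := hYX hy
      exact Subtype.ext hzy ▸ hz
    · refine (hc.image Subtype.val).mono fun y hy => ?_
      obtain ⟨z, -, rfl⟩ := hYX hy
      exact ⟨z, hy, rfl⟩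
    · obtain ⟨p, hp, hpF⟩ := hAF (F.map (Function.Embedding.subtype _)) (by
        intro y hy
        obtain ⟨z, -, rfl⟩ := Finset.mem_map.1 hy
        exact z.2) (hYc _ (by
          intro y hy
          obtain ⟨z, hz, rfl⟩ := Finset.mem_map.1 hy
          exact hF hz))
      exact ⟨⟨p, hp⟩, fun q hq => hpF q (Finset.mem_map_of_mem _ hq)⟩
  have hσ := h.isSigmaCentered hA hpreA
  obtain ⟨W, _, _, _, _, hW⟩ := exists_omegaOne.{v}
  -- The second family decides pairs: an element is below both `a` and `b` or incompatible with one
  -- of them. Pairwise compatibility excludes the latter when `a`, `b` are values of `g`.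
  let 𝓔 : 𝒟 ⊕ A × A → Set A := Sum.elim (fun D => Subtype.val ⁻¹' D.1) fun p =>
    {d | (d ≤ p.1 ∧ d ≤ p.2) ∨ (∀ q, ¬ (q ≤ d ∧ q ≤ p.1)) ∨ ∀ q, ¬ (q ≤ d ∧ q ≤ p.2)}
  have h𝓔 : ∀ i, IsForcingDense (𝓔 i) := by
    rintro (D | ⟨a, b⟩) p
    · obtain ⟨d, hd, hdA, hdp⟩ := hAD D.1 D.2 p p.2
      exact ⟨⟨d, hdA⟩, hd, hdp⟩
    · by_cases h₁ : ∃ q, q ≤ p ∧ q ≤ a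
      · obtain ⟨q, hqp, hqa⟩ := h₁
        by_cases h₂ : ∃ q', q' ≤ q ∧ q' ≤ b
        · obtain ⟨q', hq', hb⟩ := h₂
          exact ⟨q', Or.inl ⟨hq'.trans hqa, hb⟩, hq'.trans hqp⟩
        · exact ⟨q, Or.inr (Or.inr (not_exists.1 h₂)), hqp⟩
      · exact ⟨p, Or.inr (Or.inl (not_exists.1 h₁)), le_rfl⟩
  obtain ⟨p₀⟩ := this
  have : Nonempty (𝒟 ⊕ A × A) := ⟨Sum.inr (p₀, p₀)⟩
  obtain ⟨f, hf⟩ : ∃ f : W → 𝒟 ⊕ A × A, Function.Surjective f := by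
    have hinf := Cardinal.aleph0_le_aleph 1
    have hle : #(𝒟 ⊕ A × A) ≤ #W := by
      rw [hW, Cardinal.mk_sum, Cardinal.mk_prod]
      simp only [Cardinal.lift_id]
      exact Cardinal.add_le_of_le hinf h𝒟 (Cardinal.mul_le_of_le hinf hA hA)
    obtain ⟨g⟩ := Cardinal.le_def _ _ |>.1 hle
    exact ⟨_, Function.invFun_surjective g.injective⟩
  have : Nonempty A := ⟨p₀⟩
  obtain ⟨g, hg, hcomp⟩ := h.exists_compatible hW hσ (D := fun α => 𝓔 (f α)) fun α => h𝓔 _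
  have hfil : Order.IsPFilter {p : P | ∃ α, (g α : P) ≤ p} := by
    refine Order.IsPFilter.of_def ?_ ?_ ?_
    · obtain ⟨α, -⟩ := hf (Sum.inr (p₀, p₀))
      exact ⟨g α, α, le_rfl⟩
    · rintro p ⟨α, hα⟩ q ⟨β, hβ⟩
      obtain ⟨ζ, hζ⟩ := hf (Sum.inr (g α, g β))
      have hmem := hg ζ
      rw [hζ] at hmem
      rcases hmem with ⟨h₁, h₂⟩ | h' | h'
      · exact ⟨g ζ, ⟨ζ, le_rfl⟩, le_trans (Subtype.coe_le_coe.2 h₁) hα,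
          le_trans (Subtype.coe_le_coe.2 h₂) hβ⟩
      · obtain ⟨r, hr⟩ := hcomp ζ α
        exact (h' r hr).elim
      · obtain ⟨r, hr⟩ := hcomp ζ β
        exact (h' r hr).elim
    · rintro p q hpq ⟨α, hα⟩
      exact ⟨α, hα.trans hpq⟩
  refine ⟨hfil.toPFilter, fun D hD => ?_⟩
  obtain ⟨ζ, hζ⟩ := hf (Sum.inl ⟨D, hD⟩)
  have hmem := hg ζ
  rw [hζ] at hmem
  exact ⟨g ζ, ⟨ζ, le_rfl⟩, hmem⟩
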